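/- All codes are binary linear codes; an $[n,k,d]$ code is a $k$-dimensional subspace of $\mathbb F_2^n$ with minimum Hamming distance $d$; $C^\perp$ is the Euclidean dual; $C$ is self-orthogonal if $C\subseteq C^\perp$ and cyclic if it is invariant under the cyclic shift of coordinates; $C\otimes C'$ is the product code of length $nn^*$, spanned by all Kronecker products $u\otimes v$ with $u\in C$, $v\in C'$. An $(a_l,a_r)$-$[[N,K]]$ quantum synchronizable code (QSC) that corrects up to $t_z$ phase errors and up to $t_x$ bit errors is an isometric encoding $V$ of $K$ qubits into a block of $N$ qubits with the following two properties. Let $\mathcal E$ be the complex span of the Pauli operators $X^aZ^b$ on $N$ qubits with $\operatorname{wt}(a)\le t_x$ and $\operatorname{wt}(b)\le t_z$. (i) Error correction: there is a single quantum channel $\mathcal R$ from $N$ to $K$ qubits such that $\mathcal R(EV\rho V^\dagger E^\dagger)=\operatorname{tr}(EV\rho V^\dagger E^\dagger)\,\rho$ for all $E\in\mathcal E$ and all states $\rho$ of $K$ qubits. (ii) Synchronization: the block lies in a stream of qubits whose other qubits are in an arbitrary state. There is a single projective measurement on $N$ qubits such that, whenever the block is in a state $EV\varphi$ with $E\in\mathcal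 E$ and the measurement is performed on the $N$ consecutive qubits of the stream whose position is off that of the block by $\alpha$ qubits (to the left if $\alpha<0$, to the right if $\alpha>0$), where $-a_l\le\alpha\le a_r$, the outcome is $\alpha$ with certainty and the state of the stream is left unchanged. **Theorem.** Let $n$ and $n^*$ be two positive odd integers with $\gcd(n,n^*)=1$. Let $C_1$ be an $[n,k_1,d_1]$ self-orthogonal cyclic code, $C_2$ an $[n,k_2,d_2]$ cyclic code, and let $C_3$ and $C_4$ be cyclic codes with parameters $[n^*,k_3,d_3]$ and $[n^*,k_4,d_4]$, respectively, such that $(C_1\otimes C_3)^\perp\subsetneq C_2\otimes C_4$. Let $d$ be the minimum distance of $(C_1\otimes C_3)^\perp$. Then $2k_1k_3\le nn^*$, $d\ge d_2d_4$, and for every pair of nonnegative integers $(a_l,a_r)$ with $a_l+a_r<k_1k_3+k_2k_4-nn^*$ there exists an $(a_l,a_r)$-$[[nn^*+a_l+a_r,\;nn^*-2k_1k_3]]$ QSC that corrects up to $\lfloor\frac{d-1}{2}\rfloor$ phase errors and up to $\lfloor\frac{d_2d_4-1}{2}\rfloor$ bit errors. -/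

import Mathlib

open scoped Matrix ComplexOrder

noncomputable section

namespace QSync

/-! ### Binary linear codes -/

/-- Minimum distance of a binary code (meaningful for a nonzero code). -/
def minDist {ι : Type*} [Fintype ι] (C : Submodule (ZMod 2) (ι → ZMod 2)) : ℕ :=
  sInf {d | ∃ x ∈ C, ∃ y ∈ C, x ≠ y ∧ hammingDist x y = d}

/-- `C` has dimension `k` and minimum distance `d`; its length is the size of `ι`. -/
def HasParams {ι : Type*} [Fintype ι] (C : Submodule (ZMod 2) (ι → ZMod 2)) (k d : ℕ) : Prop :=
  Module.finrank (ZMod 2) C = k ∧ minDist C = d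

/-- `C` is closed under the cyclic shift of coordinates. -/
def IsCyclicCode {n : ℕ} (C : Submodule (ZMod 2) (Fin n → ZMod 2)) : Prop :=
  ∀ c ∈ C, (fun i => c (finRotate n i)) ∈ C

/-- The Euclidean dual code. -/
def dualCode {ι : Type*} [Fintype ι] (C : Submodule (ZMod 2) (ι → ZMod 2)) :
    Submodule (ZMod 2) (ι → ZMod 2) where
  carrier := {x | ∀ c ∈ C, x ⬝ᵥ c = 0}
  zero_mem' := by
    intro c _
    exact zero_dotProduct c
  add_mem' := by
    intro x y hx hy c hc
    rw [add_dotProduct, hx c hc, hy c hc, add_zero]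
  smul_mem' := by
    intro a x hx c hc
    rw [smul_dotProduct, hx c hc, smul_zero]

/-- Self-orthogonality with respect to the Euclidean inner product. -/
def IsSelfOrthogonal {ι : Type*} [Fintype ι] (C : Submodule (ZMod 2) (ι → ZMod 2)) : Prop :=
  C ≤ dualCode C

/-- The product code `C ⊗ C'`: the code spanned by the Kronecker products of a word of `C` and a
word of `C'`, that is, the row space of the Kronecker product of generator matrices. Its
coordinates are indexed by pairs, so that its length is the product of the two lengths. -/
def productCode {ι κ : Type*} (C : Submodule (ZMod 2) (ι → ZMod 2))
    (C' : Submodule (ZMod 2) (κ → ZMod 2)) : Submodule (ZMod 2) (ι × κ → ZMod 2) :=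
  Submodule.span (ZMod 2) {w | ∃ u ∈ C, ∃ v ∈ C', w = fun p => u p.1 * v p.2}

/-! ### Qubits, errors and quantum codes -/

/-- Bit strings of length `N`. They index the computational basis of `N` qubits, so a pure state
of `N` qubits is a vector `Bits N → ℂ`, and a density operator is a matrix indexed by `Bits N`. -/
abbrev Bits (N : ℕ) : Type := Fin N → ZMod 2

/-- The Pauli operator `X^a Z^b`, which sends `|y⟩` to `(-1)^(b·y) |y + a⟩`: a bit error on each
qubit of the support of `a` and a phase error on each qubit of the support of `b`. -/
def pauli {N : ℕ} (a b : Bits N) : Matrix (Bits N) (Bits N) ℂ :=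
  fun x y => if x = y + a then (-1) ^ (b ⬝ᵥ y).val else 0

/-- The errors on `N` qubits with at most `tx` bit errors and at most `tz` phase errors: all linear
combinations of the corresponding Pauli operators. -/
def errorSpace (N tx tz : ℕ) : Submodule ℂ (Matrix (Bits N) (Bits N) ℂ) :=
  Submodule.span ℂ {E | ∃ a b : Bits N, hammingNorm a ≤ tx ∧ hammingNorm b ≤ tz ∧ E = pauli a b}

/-- An `[[N, K]]` quantum code: an isometric encoding of `K` logical qubits into `N` qubits. -/
structure QuantumCode (N K : ℕ) where
  enc : Matrix (Bits N) (Bits K) ℂ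
  isometry : encᴴ * enc = 1

/-- The code corrects up to `tx` bit errors together with up to `tz` phase errors: there is one
quantum channel, with Kraus operators `R i`, which, for every such error `E` and every logical
state `ρ`, maps the (unnormalized) received state `E V ρ V* E*` to a multiple of `ρ`
of the same trace. -/
def QuantumCode.Corrects {N K : ℕ} (Q : QuantumCode N K) (tx tz : ℕ) : Prop :=
  ∃ (m : ℕ) (R : Fin m → Matrix (Bits K) (Bits N) ℂ),
    ∑ i, (R i)ᴴ * R i = 1 ∧
    ∀ E ∈ errorSpace N tx tz, ∀ ρ : Matrix (Bits K) (Bits K) ℂ, ρ.PosSemidef → ρ.trace = 1 →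
      ∑ i, R i * ((E * Q.enc) * ρ * (E * Q.enc)ᴴ) * (R i)ᴴ =
        ((E * Q.enc) * ρ * (E * Q.enc)ᴴ).trace • ρ

/-! ### Misalignment

A block of `N` qubits is part of a longer stream. Of the stream we keep the block, the `al` qubits
to the left of it and the `ar` qubits to the right of it. The receiver looks at a window of `N`
consecutive qubits of the stream. The window that starts at position `j` is misaligned by `j - al`
qubits: for `j < al` by `al - j` qubits to the left, for `j > al` by `j - al` qubits to the right,
and for `j = al` it is the block itself. -/

/-- The position in the stream of the `i`-th qubit of the window that starts at `j`. -/
def windowPos (al ar N : ℕ) (j : Fin (al + ar + 1)) (i : Fin N) : Fin (al + N + ar) :=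
  ⟨j + i, by omega⟩

/-- The state of the stream when the block is in the state `ψ` and the qubits to the left and to
the right of it are in the (arbitrary, possibly entangled) state `χ`. -/
def streamState (al ar N : ℕ) (ψ : Bits N → ℂ) (χ : Bits al → Bits ar → ℂ) :
    Bits (al + N + ar) → ℂ :=
  fun s => χ (fun i => s (Fin.castAdd ar (Fin.castAdd N i))) (fun i => s (Fin.natAdd (al + N) i)) *
    ψ (fun i => s (Fin.castAdd ar (Fin.natAdd al i)))

/-- The operator `A` on `N` qubits, applied to the window of the stream that starts at `j` (and the
identity applied to all the other qubits of the stream). -/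
def applyWindow (al ar N : ℕ) (j : Fin (al + ar + 1)) (A : Matrix (Bits N) (Bits N) ℂ)
    (Φ : Bits (al + N + ar) → ℂ) : Bits (al + N + ar) → ℂ :=
  fun s => ∑ y : Bits N, A (fun i => s (windowPos al ar N j i)) y *
    Φ (Function.extend (windowPos al ar N j) y s)

/-- The code corrects misalignments of up to `al` qubits to the left and up to `ar` qubits to the
right, in the presence of up to `tx` bit errors and up to `tz` phase errors on the block: there is
one projective measurement on `N` qubits (with pairwise orthogonal projections `P j`, and one more
outcome for the complement of their sum) such that, if it is performed on the window which starts at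
`j`, its outcome is `j` with certainty and the state of the stream is left unchanged. -/
def QuantumCode.Synchronizes {N K : ℕ} (Q : QuantumCode N K) (al ar tx tz : ℕ) : Prop :=
  ∃ P : Fin (al + ar + 1) → Matrix (Bits N) (Bits N) ℂ,
    (∀ j, (P j).IsHermitian) ∧ (∀ j, P j * P j = P j) ∧ (∀ i j, i ≠ j → P i * P j = 0) ∧
    ∀ j, ∀ E ∈ errorSpace N tx tz, ∀ (φ : Bits K → ℂ) (χ : Bits al → Bits ar → ℂ),
      applyWindow al ar N j (P j) (streamState al ar N ((E * Q.enc) *ᵥ φ) χ) =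
        streamState al ar N ((E * Q.enc) *ᵥ φ) χ

/-- `Q` is an `(al, ar)-[[N, K]]` quantum synchronizable code that corrects up to `tz` phase errors
and up to `tx` bit errors: the misalignment can be determined without disturbing the state, and the
block, once it is located, can be decoded. -/
def QuantumCode.IsQSC {N K : ℕ} (Q : QuantumCode N K) (al ar tz tx : ℕ) : Prop :=
  Q.Synchronizes al ar tx tz ∧ Q.Corrects tx tz

end QSync

end

namespace QSync

/-! ### Weights, minimum distance and dual codes -/

section Codes

variable {ι κ : Type*}

/-! Put `D = C₁ ⊗ C₃` and `B = C₂ ⊗ C₄`, so that `D ≤ dualCode D ≤ B`. Since the lengths are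
coprime, rotating both coordinates at once permutes all `n * n'` of them in a single cycle, and the
product codes are cyclic for this rotation `σ`. A cyclic code is an ideal of a quotient of `F₂[X]`,
so `B` is generated by one word `v` (`exists_generator`).

The quantum code is the CSS code of `D ≤ dualCode D`, translated by `v` and continued periodically
to `n * n' + al + ar` letters. A window at `j` shows in its middle a full period of the block: a
word of `σ ^ j v + dualCode D`, up to few bit errors. These cosets are distinct for `j` below the
codimension of `dualCode D` in `B` (`pow_sub_pow_notMem`), which is `k₁ k₃ + k₂ k₄ - n n'`. As they
lie in `B`, at most `(d₂ d₄ - 1) / 2` bit errors cannot confuse them. A diagonal measurement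
therefore reads off `j`, and it leaves the state unchanged because each erroneous state is supported
on the strings of a single outcome (`synchronizes_of_disjoint`).

For correction, a phase error on the periodic continuation folds to one on the original word without
gaining weight (`exists_dotProduct_comp`). Distinct pairs of a bit error and a folded phase error
send the code to orthogonal subspaces (`cosetEnc_conjTranspose_mul`): distinct bit errors by the
distance of `dualCode D`, distinct phases because a character nontrivial on `D` sums to zero over
it. -/

theorem minDist_le_hammingNorm [Fintype ι] {C : Submodule (ZMod 2) (ι → ZMod 2)} {x : ι → ZMod 2}
    (hx : x ∈ C) (h0 : x ≠ 0) : minDist C ≤ hammingNorm x :=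
  Nat.sInf_le ⟨x, hx, 0, C.zero_mem, h0, hammingDist_zero_right x⟩

theorem le_minDist [Fintype ι] {C : Submodule (ZMod 2) (ι → ZMod 2)} (hC : C ≠ ⊥) {m : ℕ}
    (h : ∀ x ∈ C, x ≠ 0 → m ≤ hammingNorm x) : m ≤ minDist C := by
  obtain ⟨x, hx, h0⟩ := Submodule.exists_mem_ne_zero_of_ne_bot hC
  refine le_csInf ⟨_, x, hx, 0, C.zero_mem, h0, rfl⟩ ?_
  rintro _ ⟨y, hy, z, hz, hne, rfl⟩
  rw [hammingDist_eq_hammingNorm]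
  exact h _ (C.add_mem (C.neg_mem hy) hz) fun h0 => hne (neg_add_eq_zero.mp h0)

theorem minDist_pos [Fintype ι] {C : Submodule (ZMod 2) (ι → ZMod 2)} (hC : C ≠ ⊥) :
    0 < minDist C :=
  le_minDist hC fun _ _ h0 => hammingNorm_pos_iff.mpr h0

/-- Two words of weight less than half the distance that are congruent modulo the code agree. -/
theorem eq_of_sub_mem_of_hammingNorm_le [Fintype ι] {C : Submodule (ZMod 2) (ι → ZMod 2)} {t : ℕ}
    (ht : 2 * t < minDist C) {x y : ι → ZMod 2} (hx : hammingNorm x ≤ t) (hy : hammingNorm y ≤ t)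
    (h : x - y ∈ C) : x = y := by
  by_contra hne
  have h1 := minDist_le_hammingNorm h (sub_ne_zero.mpr hne)
  rw [sub_eq_neg_add, ZModModule.neg_eq_self, ← ZModModule.neg_eq_self y,
    ← hammingDist_eq_hammingNorm, hammingDist_comm] at h1
  have h2 := hammingDist_triangle x 0 y
  rw [hammingDist_zero_right, hammingDist_zero_left] at h2
  omega

theorem finrank_add_finrank_dualCode [Fintype ι] (C : Submodule (ZMod 2) (ι → ZMod 2)) :
    Module.finrank (ZMod 2) C + Module.finrank (ZMod 2) (dualCode C) = Fintype.card ι := by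
  classical
  let B : LinearMap.BilinForm (ZMod 2) (ι → ZMod 2) := dotProductBilin (ZMod 2) (ZMod 2)
  have hB : B.IsRefl := fun x y h => by
    change y ⬝ᵥ x = 0
    rw [dotProduct_comm]; exact h
  have hnd : B.Nondegenerate := by
    refine ⟨fun x hx => ?_, fun x hx => ?_⟩
    · exact dotProduct_eq_zero _ (fun w => hx w)
    · exact dotProduct_eq_zero _ (fun w => by rw [dotProduct_comm]; exact hx w)
  have hd : B.orthogonal C = dualCode C := by
    ext x
    refine forall₂_congr fun c _ => ?_
    change c ⬝ᵥ x = 0 ↔ x ⬝ᵥ c = 0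
    rw [dotProduct_comm]
  have h := LinearMap.BilinForm.finrank_orthogonal hnd C
  have hle := Submodule.finrank_le C
  rw [hd, Module.finrank_fintype_fun_eq_card] at h
  rw [Module.finrank_fintype_fun_eq_card] at hle
  omega

/-! ### Product codes -/

theorem mul_mem_productCode {C : Submodule (ZMod 2) (ι → ZMod 2)}
    {C' : Submodule (ZMod 2) (κ → ZMod 2)} {u : ι → ZMod 2} {v : κ → ZMod 2}
    (hu : u ∈ C) (hv : v ∈ C') : (fun p : ι × κ => u p.1 * v p.2) ∈ productCode C C' :=
  Submodule.subset_span ⟨u, hu, v, hv, rfl⟩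

/-- The products of basis words form a basis. Independence is tested one row at a time, with the
second basis and then the first. -/
theorem finrank_productCode [Fintype ι] [Fintype κ] (C : Submodule (ZMod 2) (ι → ZMod 2))
    (C' : Submodule (ZMod 2) (κ → ZMod 2)) :
    Module.finrank (ZMod 2) (productCode C C') =
      Module.finrank (ZMod 2) C * Module.finrank (ZMod 2) C' := by
  let b := Module.finBasis (ZMod 2) C
  let b' := Module.finBasis (ZMod 2) C'
  let f : Fin (Module.finrank (ZMod 2) C) × Fin (Module.finrank (ZMod 2) C') → ι × κ → ZMod 2 :=
    fun ij p => (b ij.1 : ι → ZMod 2) p.1 * (b' ij.2 : κ → ZMod 2) p.2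
  have hli : LinearIndependent (ZMod 2) f := by
    rw [Fintype.linearIndependent_iff]
    intro a ha
    have hb : LinearIndependent (ZMod 2) fun i => (b i : ι → ZMod 2) :=
      b.linearIndependent.map' C.subtype C.ker_subtype
    have hb' : LinearIndependent (ZMod 2) fun i => (b' i : κ → ZMod 2) :=
      b'.linearIndependent.map' C'.subtype C'.ker_subtype
    rw [Fintype.linearIndependent_iff] at hb hb'
    have h1 : ∀ p j, ∑ i, a (i, j) * (b i : ι → ZMod 2) p = 0 := by
      intro p
      refine hb' _ ?_
      ext q
      have := congrFun ha (p, q)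
      simp only [Fintype.sum_prod_type_right, f, Finset.sum_apply, Pi.smul_apply, smul_eq_mul,
        Pi.zero_apply] at this ⊢
      rw [← this]
      refine Finset.sum_congr rfl fun j _ => ?_
      rw [Finset.sum_mul]
      exact Finset.sum_congr rfl fun i _ => by ring
    rintro ⟨i, j⟩
    refine hb (fun i => a (i, j)) ?_ i
    ext p
    simpa using h1 p j
  have hspan : Submodule.span (ZMod 2) (Set.range f) = productCode C C' := by
    refine le_antisymm (Submodule.span_le.mpr ?_) (Submodule.span_le.mpr ?_)
    · rintro _ ⟨ij, rfl⟩
      exact mul_mem_productCode (b ij.1).2 (b' ij.2).2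
    · rintro _ ⟨u, hu, v, hv, rfl⟩
      have h1 := congrArg (Subtype.val) (b.sum_repr ⟨u, hu⟩)
      have h2 := congrArg (Subtype.val) (b'.sum_repr ⟨v, hv⟩)
      have : (fun p : ι × κ => u p.1 * v p.2) =
          ∑ ij, (b.repr ⟨u, hu⟩ ij.1 * b'.repr ⟨v, hv⟩ ij.2) • f ij := by
        ext p
        have h1p := congrFun h1 p.1
        have h2p := congrFun h2 p.2
        simp only [AddSubmonoidClass.coe_finsetSum, SetLike.val_smul, Finset.sum_apply,
          Pi.smul_apply, smul_eq_mul] at h1p h2p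
        rw [← h1p, ← h2p, Finset.sum_mul_sum, ← Finset.univ_product_univ, Finset.sum_product]
        simp only [Finset.sum_apply, Pi.smul_apply, smul_eq_mul, f]
        exact Finset.sum_congr rfl fun i _ => Finset.sum_congr rfl fun j _ => by ring
      rw [this]
      exact Submodule.sum_mem _ fun ij _ => Submodule.smul_mem _ _
        (Submodule.subset_span ⟨ij, rfl⟩)
  rw [← hspan, finrank_span_eq_card hli, Fintype.card_prod, Fintype.card_fin, Fintype.card_fin]

theorem productCode_column_mem {C : Submodule (ZMod 2) (ι → ZMod 2)}
    {C' : Submodule (ZMod 2) (κ → ZMod 2)} {w : ι × κ → ZMod 2} (hw : w ∈ productCode C C')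
    (q : κ) : (fun p => w (p, q)) ∈ C := by
  induction hw using Submodule.span_induction with
  | mem x h =>
    obtain ⟨u, hu, v, _, rfl⟩ := h
    simpa [Pi.smul_def, mul_comm] using C.smul_mem (v q) hu
  | zero => exact C.zero_mem
  | add x y _ _ hx hy => exact C.add_mem hx hy
  | smul a x _ hx => exact C.smul_mem a hx

theorem productCode_row_mem {C : Submodule (ZMod 2) (ι → ZMod 2)}
    {C' : Submodule (ZMod 2) (κ → ZMod 2)} {w : ι × κ → ZMod 2} (hw : w ∈ productCode C C')
    (p : ι) : (fun q => w (p, q)) ∈ C' := by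
  induction hw using Submodule.span_induction with
  | mem x h =>
    obtain ⟨u, _, v, hv, rfl⟩ := h
    exact C'.smul_mem (u p) hv
  | zero => exact C'.zero_mem
  | add x y _ _ hx hy => exact C'.add_mem hx hy
  | smul a x _ hx => exact C'.smul_mem a hx

/-- Rows and columns of a product word are codewords. A row through a nonzero entry has at least
`minDist C'` nonzero entries, and the column through each of these has at least `minDist C`. -/
theorem minDist_mul_le_hammingNorm [Fintype ι] [Fintype κ] {C : Submodule (ZMod 2) (ι → ZMod 2)}
    {C' : Submodule (ZMod 2) (κ → ZMod 2)} {w : ι × κ → ZMod 2} (hw : w ∈ productCode C C')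
    (h0 : w ≠ 0) : minDist C * minDist C' ≤ hammingNorm w := by
  classical
  obtain ⟨⟨p₀, q₀⟩, h0⟩ := Function.ne_iff.mp h0
  have hrow : minDist C' ≤ (Finset.univ.filter fun q => w (p₀, q) ≠ 0).card :=
    minDist_le_hammingNorm (productCode_row_mem hw p₀) (Function.ne_iff.mpr ⟨q₀, h0⟩)
  have hcol : ∀ q ∈ Finset.univ.filter fun q => w (p₀, q) ≠ 0,
      minDist C ≤ ∑ p, if w (p, q) ≠ 0 then 1 else 0 := by
    intro q hq
    rw [← Finset.card_filter]
    exact minDist_le_hammingNorm (productCode_column_mem hw q)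
      (Function.ne_iff.mpr ⟨p₀, (Finset.mem_filter.mp hq).2⟩)
  calc minDist C * minDist C'
      ≤ (Finset.univ.filter fun q => w (p₀, q) ≠ 0).card * minDist C := by
        rw [mul_comm]; exact Nat.mul_le_mul_right _ hrow
    _ ≤ ∑ q ∈ Finset.univ.filter fun q => w (p₀, q) ≠ 0, ∑ p, if w (p, q) ≠ 0 then 1 else 0 := by
        rw [← smul_eq_mul]; exact Finset.card_nsmul_le_sum _ _ _ hcol
    _ ≤ ∑ q, ∑ p, if w (p, q) ≠ 0 then 1 else 0 :=
        Finset.sum_le_sum_of_subset (Finset.subset_univ _)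
    _ = hammingNorm w := by
        rw [hammingNorm, Finset.card_filter, Fintype.sum_prod_type_right]

theorem IsSelfOrthogonal.productCode [Fintype ι] [Fintype κ] {C : Submodule (ZMod 2) (ι → ZMod 2)}
    (h : IsSelfOrthogonal C) (C' : Submodule (ZMod 2) (κ → ZMod 2)) :
    IsSelfOrthogonal (productCode C C') := by
  refine Submodule.span_le.mpr ?_
  rintro _ ⟨u, hu, v, hv, rfl⟩ c hc
  induction hc using Submodule.span_induction with
  | mem x hx =>
    obtain ⟨u', hu', v', hv', rfl⟩ := hx
    have : (fun p : ι × κ => u p.1 * v p.2) ⬝ᵥ (fun p : ι × κ => u' p.1 * v' p.2) =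
        (u ⬝ᵥ u') * (v ⬝ᵥ v') := by
      simp only [dotProduct]
      rw [Finset.sum_mul_sum, ← Finset.univ_product_univ, Finset.sum_product]
      exact Finset.sum_congr rfl fun i _ => Finset.sum_congr rfl fun j _ => by ring
    rw [this, h hu u' hu', zero_mul]
  | zero => exact dotProduct_zero _
  | add x y _ _ hx hy => rw [dotProduct_add, hx, hy, add_zero]
  | smul a x _ hx => rw [dotProduct_smul, hx, smul_zero]

end Codes

/-! ### Invariance under a permutation of the coordinates -/

section Invariant

variable {ι : Type*}

/-- The action of a permutation of the coordinates on words. -/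
abbrev permWord (σ : Equiv.Perm ι) : Module.End (ZMod 2) (ι → ZMod 2) :=
  LinearMap.funLeft (ZMod 2) (ZMod 2) σ

theorem permWord_pow_apply (σ : Equiv.Perm ι) (k : ℕ) (w : ι → ZMod 2) (p : ι) :
    (permWord σ ^ k) w p = w ((σ ^ k) p) := by
  induction k generalizing w with
  | zero => rfl
  | succ k ih =>
    rw [pow_succ, Module.End.mul_apply, ih, pow_succ', Equiv.Perm.mul_apply]
    rfl

theorem pow_mem_of_invariant {σ : Equiv.Perm ι} {C : Submodule (ZMod 2) (ι → ZMod 2)}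
    (h : ∀ c ∈ C, permWord σ c ∈ C) (k : ℕ) : ∀ c ∈ C, (permWord σ ^ k) c ∈ C := by
  induction k with
  | zero => exact fun c hc => hc
  | succ k ih =>
    intro c hc
    rw [pow_succ', Module.End.mul_apply]
    exact h _ (ih c hc)

/-- The adjoint of a permutation is its inverse, which is a power of it by finiteness of the order
and so also preserves the code. -/
theorem dualCode_invariant [Fintype ι] {σ : Equiv.Perm ι} {C : Submodule (ZMod 2) (ι → ZMod 2)}
    (h : ∀ c ∈ C, permWord σ c ∈ C) : ∀ x ∈ dualCode C, permWord σ x ∈ dualCode C := by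
  classical
  intro x hx c hc
  have h1 := hx _ (pow_mem_of_invariant h (orderOf σ - 1) c hc)
  rw [← h1]
  have h2 : ∀ p, (σ ^ (orderOf σ - 1)) (σ p) = p := fun p => by
    rw [← Equiv.Perm.mul_apply, ← pow_succ, Nat.sub_add_cancel (orderOf_pos σ), pow_orderOf_eq_one,
      Equiv.Perm.one_apply]
  simp only [dotProduct]
  rw [← Equiv.sum_comp σ fun p => x p * ((permWord σ ^ (orderOf σ - 1)) c) p]
  refine Finset.sum_congr rfl fun p _ => ?_
  rw [permWord_pow_apply, h2]
  rfl

theorem permWord_iterate_mem_span {σ : Equiv.Perm ι} {v : ι → ZMod 2}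
    (q : Polynomial (ZMod 2)) :
    Polynomial.aeval (permWord σ) q v ∈
      Submodule.span (ZMod 2) (Set.range fun k : ℕ => (permWord σ ^ k) v) := by
  rw [Polynomial.aeval_eq_sum_range, LinearMap.sum_apply]
  exact Submodule.sum_mem _ fun k _ => Submodule.smul_mem _ _ (Submodule.subset_span ⟨k, rfl⟩)

/-- A code that is invariant under a transitive cyclic permutation is generated by one word. -/
theorem exists_generator [Finite ι] {σ : Equiv.Perm ι} {p₀ : ι} (hσ : ∀ p, ∃ k : ℕ, (σ ^ k) p = p₀)
    {B : Submodule (ZMod 2) (ι → ZMod 2)} (hB : ∀ c ∈ B, permWord σ c ∈ B) :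
    ∃ v ∈ B, B ≤ Submodule.span (ZMod 2) (Set.range fun k : ℕ => (permWord σ ^ k) v) := by
  classical
  have := Fintype.ofFinite ι
  let δ : ι → ZMod 2 := Pi.single p₀ 1
  have hmem : ∀ (q : Polynomial (ZMod 2)), ∀ x ∈ B, Polynomial.aeval (permWord σ) q x ∈ B := by
    intro q x hx
    refine Submodule.span_le.mpr ?_ (permWord_iterate_mem_span (σ := σ) (v := x) q)
    rintro _ ⟨k, rfl⟩
    exact pow_mem_of_invariant hB k x hx
  -- By transitivity the translates of `δ` are all the unit words, so `q ↦ q(σ) δ` maps the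
  -- polynomial ring onto the words.
  have hsurj : ∀ w : ι → ZMod 2, ∃ q : Polynomial (ZMod 2),
      Polynomial.aeval (permWord σ) q δ = w := by
    choose k hk using hσ
    intro w
    refine ⟨∑ p, Polynomial.C (w p) * Polynomial.X ^ k p, ?_⟩
    ext p
    simp only [map_sum, map_mul, Polynomial.aeval_C, map_pow, Polynomial.aeval_X,
      LinearMap.sum_apply, Finset.sum_apply, Module.End.mul_apply, Module.algebraMap_end_apply,
      Pi.smul_apply, smul_eq_mul, permWord_pow_apply, δ]
    rw [Finset.sum_eq_single p]
    · rw [hk, Pi.single_eq_same, mul_one]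
    · intro p' _ hne
      rw [Pi.single_eq_of_ne, mul_zero]
      intro h
      exact hne ((σ ^ k p').injective ((hk p').trans h.symm))
    · simp
  -- The preimage of `B` is an ideal of a principal ideal domain; its generator yields the word.
  let I : Ideal (Polynomial (ZMod 2)) :=
    { carrier := {q | Polynomial.aeval (permWord σ) q δ ∈ B}
      zero_mem' := by simp
      add_mem' := fun {a b} ha hb => by
        simpa using B.add_mem ha hb
      smul_mem' := fun a q hq => by
        simpa using hmem a _ hq }
  let g := Submodule.IsPrincipal.generator I
  refine ⟨Polynomial.aeval (permWord σ) g δ, Submodule.IsPrincipal.generator_mem I, fun b hb => ?_⟩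
  obtain ⟨q, rfl⟩ := hsurj b
  obtain ⟨r, hr⟩ := (Submodule.IsPrincipal.mem_iff_eq_smul_generator I).mp (show q ∈ I from hb)
  rw [hr, smul_eq_mul, map_mul, Module.End.mul_apply]
  exact permWord_iterate_mem_span r

/-- The iterates of a generator of `B` are pairwise incongruent modulo an invariant subcode `C`,
up to the codimension of `C` in `B`. -/
theorem pow_sub_pow_notMem [Finite ι] {σ : Equiv.Perm ι} {B C : Submodule (ZMod 2) (ι → ZMod 2)}
    (hC : ∀ c ∈ C, permWord σ c ∈ C) {v : ι → ZMod 2}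
    (hv : B ≤ Submodule.span (ZMod 2) (Set.range fun k : ℕ => (permWord σ ^ k) v)) {i j : ℕ}
    (hij : i < j) (hj : Module.finrank (ZMod 2) C + j < Module.finrank (ZMod 2) B) :
    (permWord σ ^ j) v - (permWord σ ^ i) v ∉ C := by
  classical
  intro hmem
  -- If `σ ^ j v` were congruent to an earlier iterate, `C ⊔ S` would be closed under the shift. It
  -- would then contain all iterates of `v`, hence `B`, although its dimension is at most `finrank C
  -- + j`.
  let S : Submodule (ZMod 2) (ι → ZMod 2) :=
    Submodule.span (ZMod 2) (Set.range fun k : Fin j => (permWord σ ^ (k : ℕ)) v)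
  have hgen : ∀ k < j, (permWord σ ^ k) v ∈ C ⊔ S := fun k hk =>
    Submodule.mem_sup_right (Submodule.subset_span ⟨⟨k, hk⟩, rfl⟩)
  have hjm : (permWord σ ^ j) v ∈ C ⊔ S := by
    rw [← sub_add_cancel ((permWord σ ^ j) v) ((permWord σ ^ i) v)]
    exact Submodule.add_mem _ (Submodule.mem_sup_left hmem) (hgen i hij)
  have hinv : C ⊔ S ≤ (C ⊔ S).comap (permWord σ) := by
    refine sup_le (fun c hc => Submodule.mem_sup_left (hC c hc)) (Submodule.span_le.mpr ?_)
    rintro _ ⟨k, rfl⟩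
    change permWord σ ((permWord σ ^ (k : ℕ)) v) ∈ C ⊔ S
    rw [← Module.End.mul_apply, ← pow_succ']
    rcases (Nat.succ_le_of_lt k.2).lt_or_eq with h | h
    · exact hgen _ h
    · rw [show (k : ℕ) + 1 = j from h]; exact hjm
  have hall : ∀ k : ℕ, (permWord σ ^ k) v ∈ C ⊔ S := by
    intro k
    induction k with
    | zero => exact hgen 0 (Nat.zero_lt_of_lt hij)
    | succ k ih =>
      rw [pow_succ', Module.End.mul_apply]
      exact hinv ih
  have hB : B ≤ C ⊔ S := hv.trans (Submodule.span_le.mpr (by rintro _ ⟨k, rfl⟩; exact hall k))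
  have h1 := Submodule.finrank_mono hB
  have h2 := Submodule.finrank_add_le_finrank_add_finrank C S
  have h3 : Module.finrank (ZMod 2) S ≤ j := by
    simpa [S, Set.finrank] using finrank_range_le_card (R := ZMod 2)
      fun k : Fin j => (permWord σ ^ (k : ℕ)) v
  omega

end Invariant

/-! ### The cyclic structure of the coordinates of a product code -/

section Rotation

variable {n n' : ℕ}

/-- The simultaneous rotation of both coordinates. -/
abbrev rotatePair (n n' : ℕ) : Equiv.Perm (Fin n × Fin n') :=
  (finRotate n).prodCongr (finRotate n')

theorem productCode_invariant {C : Submodule (ZMod 2) (Fin n → ZMod 2)}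
    {C' : Submodule (ZMod 2) (Fin n' → ZMod 2)} (h : IsCyclicCode C) (h' : IsCyclicCode C') :
    ∀ c ∈ productCode C C', permWord (rotatePair n n') c ∈ productCode C C' := by
  intro c hc
  refine (Submodule.span_le (p := (productCode C C').comap (permWord (rotatePair n n')))).mpr ?_ hc
  rintro _ ⟨u, hu, v, hv, rfl⟩
  exact mul_mem_productCode (h u hu) (h' v hv)

/-- The pair of residues of a natural number. -/
def residues (hn : 0 < n) (hn' : 0 < n') (t : ℕ) : Fin n × Fin n' :=
  (⟨t % n, Nat.mod_lt _ hn⟩, ⟨t % n', Nat.mod_lt _ hn'⟩)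

theorem finRotate_mod (hn : 0 < n) (t : ℕ) :
    finRotate n ⟨t % n, Nat.mod_lt _ hn⟩ = ⟨(t + 1) % n, Nat.mod_lt _ hn⟩ := by
  have : NeZero n := ⟨hn.ne'⟩
  rw [finRotate_apply]
  ext
  simp [Fin.val_add]

theorem rotatePair_residues (hn : 0 < n) (hn' : 0 < n') (t : ℕ) :
    rotatePair n n' (residues hn hn' t) = residues hn hn' (t + 1) :=
  Prod.ext (finRotate_mod hn t) (finRotate_mod hn' t)

theorem rotatePair_pow_residues (hn : 0 < n) (hn' : 0 < n') (k t : ℕ) :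
    (rotatePair n n' ^ k) (residues hn hn' t) = residues hn hn' (k + t) := by
  induction k with
  | zero => simp
  | succ k ih =>
    rw [pow_succ', Equiv.Perm.mul_apply, ih, rotatePair_residues]
    congr 1
    omega

/-- The Chinese remainder theorem: it turns pairs of residues into one cycle of length `n * n'`. -/
theorem residues_bijective (hn : 0 < n) (hn' : 0 < n') (hcop : Nat.gcd n n' = 1) :
    Function.Bijective fun t : Fin (n * n') => residues hn hn' t := by
  rw [Fintype.bijective_iff_injective_and_card]
  refine ⟨fun s t h => ?_, by simp⟩
  have h1 : (s : ℕ) ≡ t [MOD n] := congrArg (fun p : Fin n × Fin n' => (p.1 : ℕ)) h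
  have h2 : (s : ℕ) ≡ t [MOD n'] := congrArg (fun p : Fin n × Fin n' => (p.2 : ℕ)) h
  have h3 := (Nat.modEq_and_modEq_iff_modEq_mul hcop).mp ⟨h1, h2⟩
  exact Fin.ext (Nat.ModEq.eq_of_lt_of_lt h3 s.2 t.2)

theorem residues_mul (hn : 0 < n) (hn' : 0 < n') :
    residues hn hn' (n * n') = residues hn hn' 0 := by
  simp [residues]

theorem exists_rotatePair_pow_eq (hn : 0 < n) (hn' : 0 < n') (hcop : Nat.gcd n n' = 1)
    (p : Fin n × Fin n') : ∃ k : ℕ, (rotatePair n n' ^ k) p = residues hn hn' 0 := by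
  obtain ⟨t, rfl⟩ := (residues_bijective hn hn' hcop).2 p
  refine ⟨n * n' - t, ?_⟩
  rw [rotatePair_pow_residues, Nat.sub_add_cancel t.2.le, residues_mul]

end Rotation

/-! ### Recovery from orthogonal errors -/

section Recovery

/-- If a quantum operation undoes every generating error up to a scalar, in each Kraus branch, then
it corrects all their linear combinations. -/
theorem QuantumCode.corrects_of_kraus {N K tx tz : ℕ} (Q : QuantumCode N K) {S : Type*} [Fintype S]
    (R : S → Matrix (Bits K) (Bits N) ℂ) (hR : ∑ i, (R i)ᴴ * R i = 1)
    (h : ∀ a b : Bits N, hammingNorm a ≤ tx → hammingNorm b ≤ tz → ∀ i,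
      ∃ c : ℂ, R i * (pauli a b * Q.enc) = c • 1) : Q.Corrects tx tz := by
  -- Acting as a scalar in a fixed Kraus branch is linear in `E`, whereas the recovery identity is
  -- quadratic; so the span induction is done at this level.
  have hE : ∀ E ∈ errorSpace N tx tz, ∀ i, ∃ c : ℂ, R i * (E * Q.enc) = c • 1 := by
    intro E hE i
    induction hE using Submodule.span_induction with
    | mem x hx =>
      obtain ⟨a, b, ha, hb, rfl⟩ := hx
      exact h a b ha hb i
    | zero => exact ⟨0, by simp⟩
    | add x y _ _ hx hy =>
      obtain ⟨c, hc⟩ := hx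
      obtain ⟨c', hc'⟩ := hy
      exact ⟨c + c', by rw [Matrix.add_mul, Matrix.mul_add, hc, hc', add_smul]⟩
    | smul r x _ hx =>
      obtain ⟨c, hc⟩ := hx
      exact ⟨r * c, by rw [Matrix.smul_mul, Matrix.mul_smul, hc, smul_smul]⟩
  have key : ∀ E ∈ errorSpace N tx tz, ∀ ρ : Matrix (Bits K) (Bits K) ℂ, ρ.trace = 1 →
      ∑ i, R i * ((E * Q.enc) * ρ * (E * Q.enc)ᴴ) * (R i)ᴴ =
        ((E * Q.enc) * ρ * (E * Q.enc)ᴴ).trace • ρ := by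
    intro E hE' ρ hρ
    choose c hc using hE E hE'
    have hi : ∀ i, R i * ((E * Q.enc) * ρ * (E * Q.enc)ᴴ) * (R i)ᴴ = (c i * star (c i)) • ρ := by
      intro i
      have : R i * ((E * Q.enc) * ρ * (E * Q.enc)ᴴ) * (R i)ᴴ =
          (R i * (E * Q.enc)) * ρ * (R i * (E * Q.enc))ᴴ := by
        rw [Matrix.conjTranspose_mul (R i)]
        simp only [Matrix.mul_assoc]
      rw [this, hc i, Matrix.conjTranspose_smul, Matrix.conjTranspose_one]
      simp [smul_smul, mul_comm]
    have htr : ((E * Q.enc) * ρ * (E * Q.enc)ᴴ).trace = ∑ i, c i * star (c i) := by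
      have h1 : ((E * Q.enc) * ρ * (E * Q.enc)ᴴ).trace =
          (∑ i, R i * ((E * Q.enc) * ρ * (E * Q.enc)ᴴ) * (R i)ᴴ).trace := by
        rw [Matrix.trace_sum]
        conv_lhs => rw [← Matrix.one_mul ((E * Q.enc) * ρ * (E * Q.enc)ᴴ), ← hR, Matrix.sum_mul,
          Matrix.trace_sum]
        refine Finset.sum_congr rfl fun i _ => ?_
        rw [Matrix.trace_mul_comm _ ((R i)ᴴ)]
        simp only [Matrix.mul_assoc]
      rw [h1]
      simp only [hi]
      rw [← Finset.sum_smul, Matrix.trace_smul, hρ, smul_eq_mul, mul_one]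
    rw [htr, Finset.sum_smul]
    exact Finset.sum_congr rfl fun i _ => hi i
  let e := Fintype.equivFin S
  refine ⟨Fintype.card S, fun i => R (e.symm i), ?_, fun E hE' ρ _ hρ => ?_⟩
  · rw [← hR]
    exact Equiv.sum_comp e.symm fun i => (R i)ᴴ * R i
  · rw [← key E hE' ρ hρ]
    exact Equiv.sum_comp e.symm fun i =>
      R i * ((E * Q.enc) * ρ * (E * Q.enc)ᴴ) * (R i)ᴴ

/-- If the generating errors map the code isometrically onto subspaces that are pairwise equal or
orthogonal, then the code corrects their linear combinations. -/
theorem QuantumCode.corrects_of_orthogonal {N K tx tz : ℕ} (Q : QuantumCode N K) {S : Type*}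
    [Fintype S] [DecidableEq S] (W : S → Matrix (Bits N) (Bits K) ℂ)
    (hW : ∀ s t, (W s)ᴴ * W t = if s = t then 1 else 0)
    (h : ∀ a b : Bits N, hammingNorm a ≤ tx → hammingNorm b ≤ tz → ∃ s, pauli a b * Q.enc = W s) :
    Q.Corrects tx tz := by
  let Pr : Matrix (Bits N) (Bits N) ℂ := ∑ s, W s * (W s)ᴴ
  have hPrW : ∀ s, Pr * W s = W s := by
    intro s
    simp only [Pr, Matrix.sum_mul, Matrix.mul_assoc, hW]
    rw [Finset.sum_eq_single s]
    · simp
    · intro t _ hne; simp [hne]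
    · simp
  have hPrPr : Pr * Pr = Pr := by
    change Pr * ∑ s, W s * (W s)ᴴ = ∑ s, W s * (W s)ᴴ
    simp only [Matrix.mul_sum, ← Matrix.mul_assoc, hPrW]
  have hPrH : Prᴴ = Pr := by
    simp [Pr, Matrix.conjTranspose_sum, Matrix.conjTranspose_mul]
  -- The maps `(W s)ᴴ` alone only add up to `Pr`. Resetting the complement of its range to the zero
  -- string completes the channel, and these extra branches annihilate every `W s`.
  let F : Bits N → Matrix (Bits K) (Bits N) ℂ := fun y => Matrix.single 0 y 1
  have hF : ∑ y, (F y)ᴴ * F y = 1 := by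
    simp only [F, Matrix.conjTranspose_single, Matrix.single_mul_single_same, star_one, mul_one]
    exact Matrix.sum_single_one
  refine Q.corrects_of_kraus (S := S ⊕ Bits N)
    (Sum.elim (fun s => (W s)ᴴ) fun y => F y * (1 - Pr)) ?_ ?_
  · rw [Fintype.sum_sum_type]
    have : ∑ y, (F y * (1 - Pr))ᴴ * (F y * (1 - Pr)) = 1 - Pr := by
      have h1 : ∀ y, (F y * (1 - Pr))ᴴ * (F y * (1 - Pr)) = (1 - Pr) * ((F y)ᴴ * F y) * (1 - Pr) := by
        intro y
        rw [Matrix.conjTranspose_mul, Matrix.conjTranspose_sub, Matrix.conjTranspose_one, hPrH]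
        simp only [Matrix.mul_assoc]
      simp only [h1]
      rw [← Matrix.sum_mul, ← Matrix.mul_sum, hF, Matrix.mul_one, Matrix.mul_sub, Matrix.sub_mul,
        Matrix.sub_mul, hPrPr]
      simp
    simp only [Sum.elim_inl, Sum.elim_inr, Matrix.conjTranspose_conjTranspose, this]
    exact add_sub_cancel _ _
  · intro a b ha hb i
    obtain ⟨s, hs⟩ := h a b ha hb
    rw [hs]
    rcases i with t | y
    · simp only [Sum.elim_inl, hW]
      by_cases hts : t = s
      · exact ⟨1, by simp [hts]⟩
      · exact ⟨0, by simp [hts]⟩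
    · refine ⟨0, ?_⟩
      simp only [Sum.elim_inr]
      rw [Matrix.mul_assoc, Matrix.sub_mul, hPrW]
      simp

end Recovery

/-! ### Signs -/

/-- The nontrivial character of `ZMod 2`. -/
def sgn (x : ZMod 2) : ℂ := (-1) ^ x.val

theorem sgn_zero : sgn 0 = 1 := by simp [sgn]

theorem sgn_add (x y : ZMod 2) : sgn (x + y) = sgn x * sgn y := by
  have h : ∀ x y : ZMod 2, (x + y).val % 2 = (x.val + y.val) % 2 := by decide
  rw [sgn, sgn, sgn, ← pow_add, neg_one_pow_eq_pow_mod_two, h, ← neg_one_pow_eq_pow_mod_two]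

theorem star_sgn (x : ZMod 2) : star (sgn x) = sgn x := by simp [sgn]

theorem sgn_of_ne_zero {x : ZMod 2} (h : x ≠ 0) : sgn x = -1 := by
  have : x = 1 := by revert x; decide
  rw [this, sgn, ZMod.val_one, pow_one]

/-- The character sum over a code vanishes unless the character is trivial on the code. -/
theorem sum_sgn_eq_zero {ι : Type*} [Fintype ι] {D : Submodule (ZMod 2) (ι → ZMod 2)} [Fintype D]
    {β : ι → ZMod 2} (hβ : β ∉ dualCode D) : ∑ z : D, sgn (β ⬝ᵥ (z : ι → ZMod 2)) = 0 := by
  obtain ⟨c, hc, h0⟩ : ∃ c ∈ D, β ⬝ᵥ c ≠ 0 := by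
    by_contra! h
    exact hβ h
  -- Translation by `c` permutes the summands and flips every sign.
  have h1 := Equiv.sum_comp (Equiv.addRight (⟨c, hc⟩ : D))
    fun z : D => sgn (β ⬝ᵥ (z : ι → ZMod 2))
  simp only [Equiv.coe_addRight, Submodule.coe_add, dotProduct_add, sgn_add, sgn_of_ne_zero h0,
    mul_neg, mul_one, Finset.sum_neg_distrib] at h1
  exact CharZero.neg_eq_self_iff.mp h1

/-! ### Codes of CSS type on embedded words -/

section CSS

variable {ι : Type*} [Fintype ι] {N K : ℕ}

/-- The uniform superposition of the embedded words of the cosets `L l + D`, with the bit error `a`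
and the phases given by `β`. -/
noncomputable def cosetEnc (D : Submodule (ZMod 2) (ι → ZMod 2)) [Fintype D]
    (ext : (ι → ZMod 2) →ₗ[ZMod 2] Bits N) (L : Bits K → ι → ZMod 2)
    (a : Bits N) (β : ι → ZMod 2) : Matrix (Bits N) (Bits K) ℂ :=
  fun x l => ∑ z : D, if x = ext (L l + z) + a then
    (((Real.sqrt (Fintype.card D))⁻¹ : ℝ) : ℂ) * sgn (β ⬝ᵥ (L l + z)) else 0

variable {D C : Submodule (ZMod 2) (ι → ZMod 2)} [Fintype D]
  {ext : (ι → ZMod 2) →ₗ[ZMod 2] Bits N} {L : Bits K → ι → ZMod 2}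

theorem pauli_mul_cosetEnc (a b : Bits N) {β : ι → ZMod 2} (hβ : ∀ w, b ⬝ᵥ ext w = β ⬝ᵥ w) :
    pauli a b * cosetEnc D ext L 0 0 = cosetEnc D ext L a β := by
  ext x l
  simp only [Matrix.mul_apply, pauli, cosetEnc, Finset.mul_sum]
  rw [Finset.sum_comm]
  refine Finset.sum_congr rfl fun z _ => ?_
  rw [Finset.sum_eq_single (ext (L l + z) + 0)]
  · simp only [add_zero, if_true, zero_dotProduct, sgn_zero, mul_one, ← hβ]
    split_ifs
    · rw [mul_comm]; rfl
    · simp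
  · intro y _ hy
    rw [if_neg hy, mul_zero]
  · simp

/-- Distinct errors map the code to orthogonal subspaces, if embedded words with distinct errors,
labels or shifts are distinct. -/
theorem cosetEnc_conjTranspose_mul [DecidableEq ι] {a a' : Bits N} {β β' : ι → ZMod 2}
    (hinj : ∀ l l' : Bits K, ∀ z z' : D, ext (L l + z) + a = ext (L l' + z') + a' →
      a = a' ∧ l = l' ∧ z = z')
    (hβ : β - β' ∈ dualCode D → β = β') :
    (cosetEnc D ext L a β)ᴴ * cosetEnc D ext L a' β' = if a = a' ∧ β = β' then 1 else 0 := by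
  ext l l'
  set κ : ℂ := (((Real.sqrt (Fintype.card D))⁻¹ : ℝ) : ℂ) with hκ
  have hκκ : κ * κ * (Fintype.card D : ℂ) = 1 := by
    have hpos : (0 : ℝ) < Fintype.card D := by exact_mod_cast Fintype.card_pos
    have : (Real.sqrt (Fintype.card D))⁻¹ * (Real.sqrt (Fintype.card D))⁻¹ * (Fintype.card D : ℝ)
        = 1 := by
      rw [← mul_inv, Real.mul_self_sqrt hpos.le, inv_mul_cancel₀ hpos.ne']
    rw [hκ]
    exact_mod_cast this
  have hstar : star κ = κ := Complex.conj_ofReal _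
  have h1 : ((cosetEnc D ext L a β)ᴴ * cosetEnc D ext L a' β') l l' =
      ∑ z : D, ∑ z' : D, if ext (L l + z) + a = ext (L l' + z') + a' then
        κ * κ * (sgn (β ⬝ᵥ (L l + z)) * sgn (β' ⬝ᵥ (L l' + z'))) else 0 := by
    simp only [Matrix.mul_apply, Matrix.conjTranspose_apply, cosetEnc, star_sum,
      Finset.sum_mul_sum, ← hκ]
    rw [Finset.sum_comm]
    refine Finset.sum_congr rfl fun z _ => ?_
    rw [Finset.sum_comm]
    refine Finset.sum_congr rfl fun z' _ => ?_
    rw [Finset.sum_eq_single (ext (L l + z) + a)]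
    · rw [if_pos rfl, star_mul', hstar, star_sgn]
      split_ifs
      · ring
      · simp
    · intro y _ hy
      rw [if_neg hy, star_zero, zero_mul]
    · simp
  rw [h1]
  by_cases hal : a = a' ∧ l = l'
  · obtain ⟨rfl, rfl⟩ := hal
    -- Only `z' = z` survives by `hinj`, and what remains is the character of `β - β'` summed over
    -- `D`.
    have h2 : ∀ z : D, (∑ z' : D, if ext (L l + z) + a = ext (L l + z') + a then
        κ * κ * (sgn (β ⬝ᵥ (L l + z)) * sgn (β' ⬝ᵥ (L l + z'))) else 0) =
        κ * κ * sgn ((β - β') ⬝ᵥ L l) * sgn ((β - β') ⬝ᵥ (z : ι → ZMod 2)) := by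
      intro z
      rw [Finset.sum_eq_single z]
      · rw [if_pos rfl, ← sgn_add, mul_assoc (κ * κ), ← sgn_add, ← dotProduct_add, sub_dotProduct,
          CharTwo.sub_eq_add]
      · intro z' _ hz
        exact if_neg fun h => hz (hinj _ _ _ _ h).2.2.symm
      · simp
    simp only [h2]
    rw [← Finset.mul_sum]
    by_cases hb : β = β'
    · subst hb
      simp [sgn_zero, hκκ]
    · rw [sum_sgn_eq_zero fun h => hb (hβ h)]
      simp [hb]
  · have h3 : ∀ z z' : D, ext (L l + z) + a ≠ ext (L l' + z') + a' := fun z z' h =>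
      hal ⟨(hinj _ _ _ _ h).1, (hinj _ _ _ _ h).2.1⟩
    simp only [h3, if_false, Finset.sum_const_zero]
    split_ifs with h
    · rw [Matrix.one_apply_ne fun hl => hal ⟨h.1, hl⟩]
    · rfl

/-- An erroneous code state is supported on the embedded words with few bit errors. -/
theorem errorSpace_mul_cosetEnc_apply {tx tz : ℕ} {E : Matrix (Bits N) (Bits N) ℂ}
    (hE : E ∈ errorSpace N tx tz) {x : Bits N}
    (hx : ∀ (l : Bits K) (z : D) (a : Bits N), hammingNorm a ≤ tx → x ≠ ext (L l + z) + a)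
    (l : Bits K) : (E * cosetEnc D ext L 0 0) x l = 0 := by
  induction hE using Submodule.span_induction with
  | mem F hF =>
    obtain ⟨a, b, ha, -, rfl⟩ := hF
    simp only [Matrix.mul_apply, pauli, cosetEnc]
    refine Finset.sum_eq_zero fun y _ => ?_
    split_ifs with hy
    · rw [Finset.sum_eq_zero, mul_zero]
      intro z _
      refine if_neg fun h => hx l z a ha ?_
      rw [hy, h, add_zero]
    · exact zero_mul _
  | zero => simp
  | add F G _ _ hF hG => rw [Matrix.add_mul, Matrix.add_apply, hF, hG, add_zero]
  | smul r F _ hF => rw [Matrix.smul_mul, Matrix.smul_apply, hF, smul_zero]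

end CSS

/-! ### Diagonal measurements of a window -/

section Window

theorem windowPos_injective {al ar N : ℕ} (j : Fin (al + ar + 1)) :
    Function.Injective (windowPos al ar N j) := by
  intro i i' h
  have := congrArg Fin.val h
  simp only [windowPos] at this
  exact Fin.ext (by omega)

open Classical in
-- Writing the window's own letters back into `s` gives `s`, so a diagonal operator only rescales
-- each amplitude.
theorem applyWindow_diagonal {al ar N : ℕ} (j : Fin (al + ar + 1)) (S : Set (Bits N))
    (Φ : Bits (al + N + ar) → ℂ) (s : Bits (al + N + ar)) :
    applyWindow al ar N j (Matrix.diagonal fun y => if y ∈ S then 1 else 0) Φ s =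
      if (fun i => s (windowPos al ar N j i)) ∈ S then Φ s else 0 := by
  simp only [applyWindow]
  rw [Finset.sum_eq_single fun i => s (windowPos al ar N j i)]
  · have : Function.extend (windowPos al ar N j) (fun i => s (windowPos al ar N j i)) s = s := by
      funext k
      by_cases hk : ∃ i, windowPos al ar N j i = k
      · obtain ⟨i, rfl⟩ := hk
        rw [(windowPos_injective j).extend_apply]
      · rw [Function.extend_apply' _ _ _ hk]
    rw [this, Matrix.diagonal_apply_eq]
    split_ifs <;> simp
  · intro y _ hy
    rw [Matrix.diagonal_apply_ne _ hy.symm, zero_mul]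
  · simp

/-- Synchronization by a computational basis measurement: disjoint sets of strings, each of which
contains what the window can show for the corresponding misalignment. -/
theorem QuantumCode.synchronizes_of_disjoint {N K al ar tx tz : ℕ} (Q : QuantumCode N K)
    (S : Fin (al + ar + 1) → Set (Bits N)) (hS : ∀ i j, i ≠ j → Disjoint (S i) (S j))
    (T : Set (Bits N))
    (hT : ∀ E ∈ errorSpace N tx tz, ∀ x ∉ T, ∀ l, (E * Q.enc) x l = 0)
    (hTS : ∀ j, ∀ s : Bits (al + N + ar), (fun i => s (Fin.castAdd ar (Fin.natAdd al i))) ∈ T →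
      (fun i => s (windowPos al ar N j i)) ∈ S j) : Q.Synchronizes al ar tx tz := by
  classical
  refine ⟨fun j => Matrix.diagonal fun y => if y ∈ S j then 1 else 0, fun j => ?_, fun j => ?_,
    fun i j hij => ?_, fun j E hE φ χ => ?_⟩
  · rw [Matrix.isHermitian_diagonal_iff]
    intro y
    split_ifs
    · exact IsSelfAdjoint.one _
    · exact IsSelfAdjoint.zero _
  · rw [Matrix.diagonal_mul_diagonal]
    simp
  · rw [Matrix.diagonal_mul_diagonal, ← Matrix.diagonal_zero]
    congr 1
    funext y
    by_cases h : y ∈ S i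
    · simp [Set.disjoint_left.mp (hS i j hij) h]
    · simp [h]
  · funext s
    rw [applyWindow_diagonal]
    split_ifs with h
    · rfl
    · have h0 : ∀ l, (E * Q.enc) (fun i => s (Fin.castAdd ar (Fin.natAdd al i))) l = 0 :=
        hT E hE _ fun hs => h (hTS j s hs)
      simp [streamState, Matrix.mulVec, dotProduct, h0]

end Window

/-! ### Synchronizable codes from cyclic codes -/

theorem hammingNorm_comp_le {ι κ : Type*} [Fintype ι] [Fintype κ] (a : ι → ZMod 2) {g : κ → ι}
    (hg : Function.Injective g) : hammingNorm (fun p => a (g p)) ≤ hammingNorm a := by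
  classical
  refine Finset.card_le_card_of_injOn g (fun p hp => ?_) hg.injOn
  simpa using hp

/-- A phase error on a word with repeated letters acts as one on the word itself. -/
theorem exists_dotProduct_comp {ι κ : Type*} [Fintype ι] [Fintype κ] (f : κ → ι)
    (b : κ → ZMod 2) :
    ∃ β : ι → ZMod 2, (∀ w : ι → ZMod 2, (b ⬝ᵥ fun i => w (f i)) = β ⬝ᵥ w) ∧
      hammingNorm β ≤ hammingNorm b := by
  classical
  -- Sum `b` over the fibres of `f`; a nonzero fibre sum needs a position of the support of `b` in
  -- that fibre.
  refine ⟨fun p => ∑ i, if f i = p then b i else 0, fun w => ?_, ?_⟩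
  · simp only [dotProduct, Finset.sum_mul]
    rw [Finset.sum_comm]
    refine Finset.sum_congr rfl fun i _ => ?_
    simp
  · refine (Finset.card_le_card fun p hp => ?_).trans
      (Finset.card_image_le (s := Finset.univ.filter fun i => b i ≠ 0) (f := f))
    obtain ⟨i, -, hi⟩ := Finset.exists_ne_zero_of_sum_ne_zero (Finset.mem_filter.mp hp).2
    rw [Finset.mem_image]
    by_cases h : f i = p
    · exact ⟨i, by simpa [h] using hi, h⟩
    · simp [h] at hi

/-- Representatives of the cosets of a subcode, labelled by bit strings. -/
theorem exists_coset_representatives {ι : Type*} [Fintype ι]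
    {D C : Submodule (ZMod 2) (ι → ZMod 2)} (hDC : D ≤ C) {K : ℕ}
    (hK : Module.finrank (ZMod 2) D + K = Module.finrank (ZMod 2) C) :
    ∃ L : Bits K → ι → ZMod 2, (∀ l, L l ∈ C) ∧ ∀ l l', L l - L l' ∈ D → l = l' := by
  let D' := D.comap C.subtype
  have h1 : Module.finrank (ZMod 2) D' = Module.finrank (ZMod 2) D :=
    (Submodule.comapSubtypeEquivOfLe hDC).finrank_eq
  have h2 := Submodule.finrank_quotient_add_finrank D'
  have h3 : Module.finrank (ZMod 2) (Bits K) = Module.finrank (ZMod 2) (C ⧸ D') := by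
    rw [Module.finrank_fintype_fun_eq_card, Fintype.card_fin]
    omega
  let q : Bits K ≃ₗ[ZMod 2] C ⧸ D' := LinearEquiv.ofFinrankEq _ _ h3
  choose r hr using D'.mkQ_surjective
  refine ⟨fun l => r (q l), fun l => (r (q l)).2, fun l l' h => ?_⟩
  have : D'.mkQ (r (q l)) = D'.mkQ (r (q l')) := (Submodule.Quotient.eq D').mpr h
  rw [hr, hr] at this
  exact q.injective this

section Construction

variable {n n' : ℕ} (hn : 0 < n) (hn' : 0 < n')

/-- The first `N` letters of the periodic sequence given by a word on pairs of residues. -/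
abbrev periodicWord (N : ℕ) : (Fin n × Fin n' → ZMod 2) →ₗ[ZMod 2] Bits N :=
  LinearMap.funLeft (ZMod 2) (ZMod 2) fun i : Fin N => residues hn hn' i

/-- One full period of a string, from position `al` on. -/
noncomputable def middleWord (hcop : Nat.gcd n n' = 1) {al ar : ℕ} (y : Bits (n * n' + al + ar)) :
    Fin n × Fin n' → ZMod 2 :=
  fun p => y ⟨al + (Equiv.ofBijective _ (residues_bijective hn hn' hcop)).symm p, by omega⟩

variable {hn hn'}

/-- The window at `j` shows in its middle the word of the block, rotated `j` times. -/
theorem middleWord_window (hcop : Nat.gcd n n' = 1) {al ar : ℕ} (j : Fin (al + ar + 1))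
    (s : Bits (al + (n * n' + al + ar) + ar)) (c : Fin n × Fin n' → ZMod 2)
    (a : Bits (n * n' + al + ar))
    (hs : (fun i => s (Fin.castAdd ar (Fin.natAdd al i))) =
      periodicWord hn hn' (n * n' + al + ar) c + a) :
    ∃ e : Fin n × Fin n' → ZMod 2, hammingNorm e ≤ hammingNorm a ∧
      middleWord hn hn' hcop (fun i => s (windowPos al ar _ j i)) =
        (permWord (rotatePair n n') ^ (j : ℕ)) c + e := by
  let idx := (Equiv.ofBijective _ (residues_bijective hn hn' hcop)).symm
  -- Starting the middle at `al` puts it at block position `j + idx p`, which stays inside the block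
  -- because `j ≤ al + ar`.
  let g : Fin n × Fin n' → Fin (n * n' + al + ar) := fun p => ⟨j + idx p, by omega⟩
  have hg : Function.Injective g := fun p p' h => by
    have : (j : ℕ) + idx p = j + idx p' := congrArg Fin.val h
    exact idx.injective (Fin.ext (by omega))
  refine ⟨fun p => a (g p), hammingNorm_comp_le a hg, ?_⟩
  ext p
  have h1 := congrFun hs (g p)
  have hp : residues hn hn' (idx p) = p :=
    (Equiv.ofBijective _ (residues_bijective hn hn' hcop)).apply_symm_apply p
  have h2 : (permWord (rotatePair n n') ^ (j : ℕ)) c p =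
      periodicWord hn hn' (n * n' + al + ar) c (g p) := by
    rw [permWord_pow_apply]
    conv_lhs => rw [← hp, rotatePair_pow_residues]
    rfl
  rw [Pi.add_apply, h2]
  refine Eq.trans ?_ h1
  simp only [middleWord, windowPos]
  congr 1
  ext
  simp only [Fin.val_castAdd, Fin.val_natAdd, g, idx]
  omega

/-- The first `n * n'` letters form a full period. There the two errors differ by a word of `C` and
thus agree, so `c = c'`; cancelling then gives `a = a'` on the repeated letters too. -/
theorem periodicWord_sub_eq_zero (hcop : Nat.gcd n n' = 1) {al ar t : ℕ}
    {C : Submodule (ZMod 2) (Fin n × Fin n' → ZMod 2)} (ht : 2 * t < minDist C)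
    {c c' : Fin n × Fin n' → ZMod 2} (hc : c - c' ∈ C) {a a' : Bits (n * n' + al + ar)}
    (ha : hammingNorm a ≤ t) (ha' : hammingNorm a' ≤ t)
    (h : periodicWord hn hn' (n * n' + al + ar) c + a =
      periodicWord hn hn' (n * n' + al + ar) c' + a') : a = a' ∧ c = c' := by
  let idx := (Equiv.ofBijective _ (residues_bijective hn hn' hcop)).symm
  let g : Fin n × Fin n' → Fin (n * n' + al + ar) := fun p => ⟨idx p, by omega⟩
  have hg : Function.Injective g := fun p p' h =>
    idx.injective (Fin.ext (congrArg Fin.val h :))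
  have hp : ∀ p, residues hn hn' (idx p) = p :=
    (Equiv.ofBijective _ (residues_bijective hn hn' hcop)).apply_symm_apply
  have hg' : ∀ w p, periodicWord hn hn' (n * n' + al + ar) w (g p) = w p := fun w p =>
    congrArg w (hp p)
  have h1 : ∀ p, c p + a (g p) = c' p + a' (g p) := by
    intro p
    have := congrFun h (g p)
    rwa [Pi.add_apply, Pi.add_apply, hg', hg'] at this
  have h2 : (fun p => a' (g p)) - (fun p => a (g p)) = c - c' := by
    ext p
    rw [Pi.sub_apply, Pi.sub_apply, sub_eq_sub_iff_add_eq_add, add_comm, ← h1 p]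
  have h3 := eq_of_sub_mem_of_hammingNorm_le ht ((hammingNorm_comp_le a' hg).trans ha')
    ((hammingNorm_comp_le a hg).trans ha) (h2 ▸ hc)
  have h4 : c = c' := by
    rw [h3, sub_self] at h2
    exact sub_eq_zero.mp h2.symm
  subst h4
  exact ⟨add_left_cancel h, rfl⟩

end Construction

/-- A self-orthogonal cyclic code whose dual is contained in a larger cyclic code gives a quantum
synchronizable code. -/
theorem exists_isQSC {n n' : ℕ} (hn : 0 < n) (hn' : 0 < n') (hcop : Nat.gcd n n' = 1)
    {D B : Submodule (ZMod 2) (Fin n × Fin n' → ZMod 2)} (hself : IsSelfOrthogonal D)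
    (hDB : dualCode D ≤ B) (hD : ∀ c ∈ D, permWord (rotatePair n n') c ∈ D)
    (hB : ∀ c ∈ B, permWord (rotatePair n n') c ∈ B) {tx tz : ℕ} (htx : 2 * tx < minDist B)
    (htz : 2 * tz < minDist (dualCode D)) (htx' : 2 * tx < minDist (dualCode D)) {al ar K : ℕ}
    (hK : Module.finrank (ZMod 2) D + K = Module.finrank (ZMod 2) (dualCode D))
    (hal : Module.finrank (ZMod 2) (dualCode D) + (al + ar) < Module.finrank (ZMod 2) B) :
    ∃ Q : QuantumCode (n * n' + al + ar) K, Q.IsQSC al ar tz tx := by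
  classical
  have : Fintype D := Fintype.ofFinite D
  let σ := rotatePair n n'
  have hC := dualCode_invariant hD
  obtain ⟨v, hvB, hv⟩ := exists_generator (exists_rotatePair_pow_eq hn hn' hcop) hB
  obtain ⟨L₀, hL₀, hL⟩ := exists_coset_representatives hself hK
  -- The shift by `v` carries the synchronization: without it every window would show a word of
  -- `dualCode D`, whatever the misalignment.
  let L : Bits K → Fin n × Fin n' → ZMod 2 := fun l => v + L₀ l
  let ext := periodicWord hn hn' (n * n' + al + ar)
  have hmem : ∀ l, ∀ z : D, L₀ l + z ∈ dualCode D := fun l z =>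
    Submodule.add_mem _ (hL₀ l) (hself z.2)
  have hinj : ∀ a a' : Bits (n * n' + al + ar), hammingNorm a ≤ tx → hammingNorm a' ≤ tx →
      ∀ l l' : Bits K, ∀ z z' : D, ext (L l + z) + a = ext (L l' + z') + a' →
        a = a' ∧ l = l' ∧ z = z' := by
    intro a a' ha ha' l l' z z' h
    have hsub : L l + z - (L l' + z') ∈ dualCode D := by
      have := Submodule.sub_mem _ (hmem l z) (hmem l' z')
      rwa [show L l + z - (L l' + z') = L₀ l + z - (L₀ l' + z') by simp only [L]; abel]
    obtain ⟨h1, h2⟩ := periodicWord_sub_eq_zero hcop htx' hsub ha ha' h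
    have h3 : L₀ l - L₀ l' = (z' - z : D) := by
      simp only [L, add_assoc, add_right_inj] at h2
      rw [Submodule.coe_sub, sub_eq_sub_iff_add_eq_add, h2, add_comm]
    have h4 : l = l' := hL l l' (h3 ▸ (z' - z).2)
    subst h4
    exact ⟨h1, rfl, Subtype.ext (add_left_cancel h2)⟩
  have hβ : ∀ β β' : Fin n × Fin n' → ZMod 2, hammingNorm β ≤ tz → hammingNorm β' ≤ tz →
      β - β' ∈ dualCode D → β = β' := fun β β' => eq_of_sub_mem_of_hammingNorm_le htz
  have h00 := cosetEnc_conjTranspose_mul (D := D) (ext := ext) (L := L) (a := 0) (a' := 0) (β := 0)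
    (β' := 0) (hinj 0 0 (by simp) (by simp)) fun _ => rfl
  rw [if_pos ⟨rfl, rfl⟩] at h00
  let Q : QuantumCode (n * n' + al + ar) K := ⟨cosetEnc D ext L 0 0, h00⟩
  refine ⟨Q, ?_, ?_⟩
  · let S : Fin (al + ar + 1) → Set (Bits (n * n' + al + ar)) := fun j =>
      {y | ∃ c ∈ dualCode D, ∃ e : Fin n × Fin n' → ZMod 2, hammingNorm e ≤ tx ∧
        middleWord hn hn' hcop y = (permWord σ ^ (j : ℕ)) v + c + e}
    have hlt : ∀ i j : Fin (al + ar + 1), i < j → Disjoint (S i) (S j) := by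
      intro i j hij
      rw [Set.disjoint_left]
      rintro y ⟨c, hc, e, he, hy⟩ ⟨c', hc', e', he', hy'⟩
      have hpow : ∀ k : ℕ, (permWord σ ^ k) v ∈ B := fun k => pow_mem_of_invariant hB k v hvB
      -- Both noiseless words lie in `B`, so the distance of `B` forces `e = e'`, leaving a
      -- congruence of iterates of `v` modulo `dualCode D`.
      have h1 : e - e' = (permWord σ ^ (j : ℕ)) v + c' - ((permWord σ ^ (i : ℕ)) v + c) := by
        rw [sub_eq_sub_iff_add_eq_add, add_comm e, ← hy, hy']
      have h2 : e = e' := eq_of_sub_mem_of_hammingNorm_le htx he he' (h1 ▸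
        B.sub_mem (B.add_mem (hpow _) (hDB hc')) (B.add_mem (hpow _) (hDB hc)))
      refine pow_sub_pow_notMem hC hv (i := i) (j := j) hij (by omega) ?_
      rw [h2, sub_self] at h1
      have h3 : (permWord σ ^ (j : ℕ)) v - (permWord σ ^ (i : ℕ)) v = c - c' := by
        rw [sub_eq_sub_iff_add_eq_add, sub_eq_zero.mp h1.symm, add_comm]
      exact h3 ▸ Submodule.sub_mem _ hc hc'
    refine Q.synchronizes_of_disjoint S (fun i j hij => ?_)
      {x | ∃ (l : Bits K) (z : D) (a : Bits (n * n' + al + ar)), hammingNorm a ≤ tx ∧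
        x = ext (L l + z) + a} (fun E hE x hx l => ?_) (fun j s hs => ?_)
    · rcases lt_or_gt_of_ne hij with h | h
      · exact hlt i j h
      · exact (hlt j i h).symm
    · exact errorSpace_mul_cosetEnc_apply hE (fun l z a ha h => hx ⟨l, z, a, ha, h⟩) l
    · obtain ⟨l, z, a, ha, hs⟩ := hs
      obtain ⟨e, he, h⟩ := middleWord_window hcop j s _ a hs
      refine ⟨(permWord σ ^ (j : ℕ)) (L₀ l + z), pow_mem_of_invariant hC _ _ (hmem l z), e,
        he.trans ha, ?_⟩
      rw [h, ← map_add, ← add_assoc]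
  -- Errors are indexed by the folded phase `β` rather than by `b`: different `b` with the same `β`
  -- act identically on the code.
  · let I := {a : Bits (n * n' + al + ar) // hammingNorm a ≤ tx} ×
      {β : Fin n × Fin n' → ZMod 2 // hammingNorm β ≤ tz}
    refine Q.corrects_of_orthogonal (S := I) (fun s => cosetEnc D ext L s.1.1 s.2.1)
      (fun s t => ?_) fun a b ha hb => ?_
    · rw [cosetEnc_conjTranspose_mul (hinj _ _ s.1.2 t.1.2) (hβ _ _ s.2.2 t.2.2)]
      exact if_congr ⟨fun h => Prod.ext (Subtype.ext h.1) (Subtype.ext h.2),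
        fun h => h ▸ ⟨rfl, rfl⟩⟩ rfl rfl
    · obtain ⟨β, h1, h2⟩ := exists_dotProduct_comp
        (fun i : Fin (n * n' + al + ar) => residues hn hn' i) b
      exact ⟨(⟨a, ha⟩, ⟨β, h2.trans hb⟩), pauli_mul_cosetEnc a b h1⟩

end QSync

theorem mainTheorem9 (n n' : ℕ) (hn : Odd n) (hn' : Odd n') (hcop : Nat.gcd n n' = 1)
    (k₁ k₂ k₃ k₄ d₁ d₂ d₃ d₄ : ℕ)
    (C₁ C₂ : Submodule (ZMod 2) (Fin n → ZMod 2))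
    (C₃ C₄ : Submodule (ZMod 2) (Fin n' → ZMod 2))
    (hp₁ : QSync.HasParams C₁ k₁ d₁) (hp₂ : QSync.HasParams C₂ k₂ d₂)
    (hp₃ : QSync.HasParams C₃ k₃ d₃) (hp₄ : QSync.HasParams C₄ k₄ d₄)
    (hc₁ : QSync.IsCyclicCode C₁) (hc₂ : QSync.IsCyclicCode C₂)
    (hc₃ : QSync.IsCyclicCode C₃) (hc₄ : QSync.IsCyclicCode C₄)
    (hself : QSync.IsSelfOrthogonal C₁)
    (hlt : QSync.dualCode (QSync.productCode C₁ C₃) < QSync.productCode C₂ C₄)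
    (d : ℕ) (hd : d = QSync.minDist (QSync.dualCode (QSync.productCode C₁ C₃))) :
    2 * (k₁ * k₃) ≤ n * n' ∧ d₂ * d₄ ≤ d ∧
    ∀ al ar : ℕ, (al : ℤ) + ar < (k₁ : ℤ) * k₃ + (k₂ : ℤ) * k₄ - (n : ℤ) * n' →
      ∃ Q : QSync.QuantumCode (n * n' + al + ar) (n * n' - 2 * (k₁ * k₃)),
        Q.IsQSC al ar ((d - 1) / 2) ((d₂ * d₄ - 1) / 2) := by

  obtain ⟨rfl, rfl⟩ := hp₁
  obtain ⟨rfl, rfl⟩ := hp₂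
  obtain ⟨rfl, rfl⟩ := hp₃
  obtain ⟨rfl, rfl⟩ := hp₄
  subst hd
  set D := QSync.productCode C₁ C₃ with hDdef
  have hD : QSync.IsSelfOrthogonal D := hself.productCode C₃
  have h1 := QSync.finrank_add_finrank_dualCode D
  have h2 := Submodule.finrank_mono hD
  have h3 := QSync.finrank_productCode C₁ C₃
  have h4 := QSync.finrank_productCode C₂ C₄
  rw [← hDdef] at h3
  rw [Fintype.card_prod, Fintype.card_fin, Fintype.card_fin] at h1
  have hpos : 0 < n * n' := Nat.mul_pos hn.pos hn'.pos
  -- A zero dual would force `D` to be zero by self-orthogonality, against the positive length.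
  have hC : QSync.dualCode D ≠ ⊥ := fun h => by
    rw [h, finrank_bot] at h1 h2
    omega
  have hB : QSync.productCode C₂ C₄ ≠ ⊥ := ne_bot_of_gt hlt
  have hBd := QSync.le_minDist hB fun x => QSync.minDist_mul_le_hammingNorm
  have hCd := QSync.le_minDist hC fun x hx =>
    QSync.minDist_mul_le_hammingNorm (hlt.le hx)
  -- Positivity guards the truncated subtraction: `2 * ((m - 1) / 2) < m` fails at `m = 0`.
  have hd : 0 < QSync.minDist C₂ * QSync.minDist C₄ := by
    have hfin : Module.finrank (ZMod 2) C₂ * Module.finrank (ZMod 2) C₄ ≠ 0 := by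
      rw [← h4, Ne, Submodule.finrank_eq_zero]
      exact hB
    refine Nat.mul_pos (QSync.minDist_pos fun h => ?_) (QSync.minDist_pos fun h => ?_)
    · exact left_ne_zero_of_mul hfin (Submodule.finrank_eq_zero.mpr h)
    · exact right_ne_zero_of_mul hfin (Submodule.finrank_eq_zero.mpr h)
  refine ⟨by omega, hCd, fun al ar hal => ?_⟩
  rw [← h3]
  refine QSync.exists_isQSC hn.pos hn'.pos hcop hD hlt.le
    (QSync.productCode_invariant hc₁ hc₃) (QSync.productCode_invariant hc₂ hc₄)
    (by omega) (by omega) (by omega) (by omega) ?_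
  rw [← Nat.cast_mul, ← Nat.cast_mul, ← Nat.cast_mul, ← h3, ← h4] at hal
  omega
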